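/- Let $\mathbf{X}$ be a represented space, let $\mathcal{O}(\mathbf{X})$ be the represented space of its open subsets (identified with the continuous functions from $\mathbf{X}$ to Sierpiński space) and let $\mathcal{K}(\mathbf{X})$ be the represented space of its (saturated) compact subsets, where $K$ is identified with $\{U \in \mathcal{O}(\mathbf{X}) \mid K \subseteq U\} \in \mathcal{O}(\mathcal{O}(\mathbf{X}))$. Suppose that: 1. $\mathbf{X}$ has an effective countable basis $(U_n)_{n \in \mathbb{N}}$, i.e. $(U_n)_{n\in\mathbb{N}}$ is a computable sequence in $\mathcal{O}(\mathbf{X})$, and given $x \in \mathbf{X}$ and $U \in \mathcal{O}(\mathbf{X})$ with $x \in U$ one can compute some $n$ with $x \in U_n \subseteq U$; 2. $\mathbf{X}$ admits a representation $\delta$ (computably equivalent to its given one) such that there is a computable sequence $(p_n)_{n \in \mathbb{N}}$ that is contained and dense in $\operatorname{dom}(\delta) \subseteq \mathbb{N}^{\mathbb{N}}$; 3. the partial multivalued map $\mathrm{CompactBase} : \subseteq \mathbf{X} \times \mathcal{O}(\mathbf{X}) \rightrightarrows \mathcal{O}(\mathbf{X}) \times \mathcal{K}(\mathbf{X})$ with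 domain $\{(x,U) \mid x \in U\}$, and with $(V,K) \in \mathrm{CompactBase}(x,U)$ iff $x \in V \subseteq K \subseteq U$, is computable. Then there are a sequence $(B_n)_{n \in \mathbb{N}}$ in $\mathcal{K}(\mathbf{X})$ and a relation $R \subseteq \mathbb{N} \times \mathbb{N}$ such that $((U_n)_{n \in \mathbb{N}}, (B_n)_{n \in \mathbb{N}}, R)$ is an effective relatively compact system (ercs) of $\mathbf{X}$, i.e. $(U_n)_{n\in\mathbb{N}}$ is a computable sequence in $\mathcal{O}(\mathbf{X})$, $(B_n)_{n\in\mathbb{N}}$ is a computable sequence in $\mathcal{K}(\mathbf{X})$, $R$ is computably enumerable, $(m,n) \in R$ implies $U_m \subseteq B_n$, and every $U \in \mathcal{O}(\mathbf{X})$ satisfies $$U = \bigcup_{\{n \mid U \supseteq B_n\}} \ \bigcup_{\{m \mid (m,n) \in R\}} U_m .$$ -/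

import Mathlib

namespace TTE

universe u v

/-- The finite initial segment of length `n` of a point of Baire space. -/
def initSeg (p : ℕ → ℕ) (n : ℕ) : List ℕ := (List.range n).map p

/-- `a w k` is the `k`-th output symbol, if it is already determined by the input prefix `w`
(`none`: read more input).  `Evaluates a p q` says that the partial continuous function on Baire
space given by `a` is defined at `p` with value `q`; the first answer given counts. -/
def Evaluates (a : List ℕ → ℕ → Option ℕ) (p q : ℕ → ℕ) : Prop :=
  ∀ k, ∃ n, a (initSeg p n) k = some (q k) ∧ ∀ m < n, a (initSeg p m) k = none

theorem Evaluates.unique {a : List ℕ → ℕ → Option ℕ} {p q r : ℕ → ℕ}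
    (hq : Evaluates a p q) (hr : Evaluates a p r) : q = r := by
  funext k
  obtain ⟨n, h1, h2⟩ := hq k
  obtain ⟨m, h3, h4⟩ := hr k
  rcases lt_trichotomy n m with h | h | h
  · rw [h4 n h] at h1
    cases h1
  · subst h
    rw [h1] at h3
    exact Option.some.inj h3
  · rw [h2 m h] at h3
    cases h3

/-- A representation of `X`: a partial surjection from Baire space onto `X`, given by its graph.
`δ.Names p x` means `δ(p) = x`. -/
structure Representation (X : Type u) where
  Names : (ℕ → ℕ) → X → Prop
  functional : ∀ p x y, Names p x → Names p y → x = y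
  surjective : ∀ x, ∃ p, Names p x

/-- The domain of a representation. -/
def Representation.dom {X : Type u} (δ : Representation X) : Set (ℕ → ℕ) :=
  {p | ∃ x, δ.Names p x}

/-- The represented space of natural numbers: `p` names `p 0`. -/
def natRep : Representation ℕ where
  Names p n := p 0 = n
  functional _ _ _ h h' := h.symm.trans h'
  surjective n := ⟨fun _ => n, rfl⟩

/-- Sierpinski space: `False` is named by the zero sequence only, `True` by every other one. -/
def sierpinski : Representation Prop where
  Names p b := b ↔ ∃ n, p n ≠ 0
  functional _ _ _ h h' := propext (h.trans h'.symm)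
  surjective b := by
    by_cases hb : b
    · exact ⟨fun _ => 1, iff_of_true hb ⟨0, one_ne_zero⟩⟩
    · exact ⟨fun _ => 0, iff_of_false hb (fun ⟨_, h⟩ => h rfl)⟩

/-- The product of two represented spaces: a name of `(x, y)` interleaves names of `x` and `y`. -/
def prodRep {X : Type u} {Y : Type v} (δ : Representation X) (ε : Representation Y) :
    Representation (X × Y) where
  Names p z := δ.Names (fun n => p (2 * n)) z.1 ∧ ε.Names (fun n => p (2 * n + 1)) z.2
  functional _ _ _ h h' :=
    Prod.ext (δ.functional _ _ _ h.1 h'.1) (ε.functional _ _ _ h.2 h'.2)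
  surjective z := by
    obtain ⟨p, hp⟩ := δ.surjective z.1
    obtain ⟨q, hq⟩ := ε.surjective z.2
    refine ⟨fun n => if n % 2 = 0 then p (n / 2) else q (n / 2), ?_, ?_⟩
    · have h : (fun n => if (2 * n) % 2 = 0 then p ((2 * n) / 2) else q ((2 * n) / 2)) = p := by
        funext n
        have h1 : (2 * n) % 2 = 0 := by omega
        have h2 : (2 * n) / 2 = n := by omega
        rw [if_pos h1, h2]
      simpa only [h] using hp
    · have h : (fun n => if (2 * n + 1) % 2 = 0 then p ((2 * n + 1) / 2)
          else q ((2 * n + 1) / 2)) = q := by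
        funext n
        have h1 : ¬ (2 * n + 1) % 2 = 0 := by omega
        have h2 : (2 * n + 1) / 2 = n := by omega
        rw [if_neg h1, h2]
      simpa only [h] using hq

/-- The partial multivalued function with domain `D` whose admissible values at `x` are the `y`
with `f x y` is computable: some computable partial function on Baire space maps every name of
every `x` in `D` to a name of some admissible value. -/
def ComputableMulti {X : Type u} {Y : Type v} (δ : Representation X) (ε : Representation Y)
    (D : X → Prop) (f : X → Y → Prop) : Prop :=
  ∃ a : List ℕ → ℕ → Option ℕ, Computable₂ a ∧
    ∀ p x, δ.Names p x → D x → ∃ q y, Evaluates a p q ∧ ε.Names q y ∧ f x y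

/-- Computable equivalence of two representations of the same set: the identity is computable
in both directions. -/
def Equivalent {X : Type u} (δ ε : Representation X) : Prop :=
  ComputableMulti δ ε (fun _ => True) (fun x y => x = y) ∧
    ComputableMulti ε δ (fun _ => True) (fun x y => x = y)

/-- A computable sequence of points: names of the `x n` can be computed uniformly in `n`. -/
def ComputableSeq {X : Type u} (δ : Representation X) (x : ℕ → X) : Prop :=
  ∃ g : ℕ → ℕ → ℕ, Computable₂ g ∧ ∀ n, δ.Names (g n) (x n)

/-- The point `p` of Baire space, read as (the code of) a partial continuous function on Baire
space: `0` stands for `none` and `m + 1` for `some m`. -/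
def decodeFun (p : ℕ → ℕ) : List ℕ → ℕ → Option ℕ :=
  fun w k => Nat.ppred (p (Encodable.encode (w, k)))

/-- The function coded by `p` is a realizer of `f`. -/
def Realizes {X : Type u} {Y : Type v} (δ : Representation X) (ε : Representation Y)
    (p : ℕ → ℕ) (f : X → Y) : Prop :=
  ∀ q x, δ.Names q x → ∃ r, Evaluates (decodeFun p) q r ∧ ε.Names r (f x)

/-- The continuous functions between represented spaces: those with a continuous realizer. -/
def ContFun {X : Type u} {Y : Type v} (δ : Representation X) (ε : Representation Y) :
    Type (max u v) :=
  {f : X → Y // ∃ p, Realizes δ ε p f}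

/-- The function space `C(X, Y)`: a continuous function is named by its coded realizers. -/
def funRep {X : Type u} {Y : Type v} (δ : Representation X) (ε : Representation Y) :
    Representation (ContFun δ ε) where
  Names p f := Realizes δ ε p f.1
  functional p f g hf hg := by
    apply Subtype.ext
    funext x
    obtain ⟨q, hq⟩ := δ.surjective x
    obtain ⟨r, hr, hr'⟩ := hf q x hq
    obtain ⟨s, hs, hs'⟩ := hg q x hq
    have h : r = s := hr.unique hs
    subst h
    exact ε.functional r _ _ hr' hs'
  surjective f := f.2

/-- The open subsets of a represented space, identified with their characteristic functions into
Sierpinski space.  (These are the open sets of the final topology of the representation.) -/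
abbrev OpenSet {X : Type u} (δ : Representation X) : Type u := ContFun δ sierpinski

/-- The points of an open set. -/
def OpenSet.toSet {X : Type u} {δ : Representation X} (U : OpenSet δ) : Set X := {x | U.1 x}

/-- The represented space `O(X) = C(X, S)` of open sets. -/
def openRep {X : Type u} (δ : Representation X) : Representation (OpenSet δ) :=
  funRep δ sierpinski

/-- The (characteristic function of the) collection of open sets that contain the set `K`. -/
def covers {X : Type u} (δ : Representation X) (K : Set X) : OpenSet δ → Prop :=
  fun U => K ⊆ U.toSet

/-- The points of `K(X)`: the saturated sets `K` (intersections of open sets) that are compact,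
in the sense that the open sets which contain `K` form an open subset of `O(X)`. -/
structure CompactSet {X : Type u} (δ : Representation X) where
  toSet : Set X
  saturated : ∀ x, (∀ U : OpenSet δ, toSet ⊆ U.toSet → x ∈ U.toSet) → x ∈ toSet
  compact : ∃ p, Realizes (openRep δ) sierpinski p (covers δ toSet)

/-- The represented space `K(X)` of compact sets: a name of `K` is a name of
`{U | K ⊆ U}` as a point of `O(O(X))`. -/
def compactRep {X : Type u} (δ : Representation X) : Representation (CompactSet δ) where
  Names p K := (openRep (openRep δ)).Names p ⟨covers δ K.toSet, K.compact⟩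
  functional p K L hK hL := by
    have h := congrArg Subtype.val ((openRep (openRep δ)).functional p _ _ hK hL)
    have h' : ∀ U : OpenSet δ, K.toSet ⊆ U.toSet ↔ L.toSet ⊆ U.toSet := fun U =>
      iff_of_eq (congrFun h U)
    have hs : K.toSet = L.toSet := by
      apply Set.Subset.antisymm
      · exact fun x hx => L.saturated x fun U hU => (h' U).2 hU hx
      · exact fun x hx => K.saturated x fun U hU => (h' U).1 hU hx
    cases K
    cases L
    cases hs
    rfl
  surjective K := K.compact

/-- `U` is an effective countable basis: a computable sequence of open sets such that from a point
`x` and an open set `V` containing it one can compute some `n` with `x ∈ U n ⊆ V`. -/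
structure IsEffectiveCountableBasis {X : Type u} (δ : Representation X) (U : ℕ → OpenSet δ) :
    Prop where
  computable : ComputableSeq (openRep δ) U
  basis : ComputableMulti (prodRep δ (openRep δ)) natRep (fun z => z.1 ∈ z.2.toSet)
    (fun z n => z.1 ∈ (U n).toSet ∧ (U n).toSet ⊆ z.2.toSet)

/-- The map `CompactBase`, which takes a point `x` and an open set `U` containing it to some open
`V` and compact `K` with `x ∈ V ⊆ K ⊆ U`, is computable. -/
def EffectivelyLocallyCompact {X : Type u} (δ : Representation X) : Prop :=
  ComputableMulti (prodRep δ (openRep δ)) (prodRep (openRep δ) (compactRep δ))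
    (fun z => z.1 ∈ z.2.toSet)
    (fun z w => z.1 ∈ w.1.toSet ∧ w.1.toSet ⊆ w.2.toSet ∧ w.2.toSet ⊆ z.2.toSet)

/-- `(U, B, R)` is an effective relatively compact system. -/
structure IsErcs {X : Type u} (δ : Representation X) (U : ℕ → OpenSet δ)
    (B : ℕ → CompactSet δ) (R : ℕ → ℕ → Prop) : Prop where
  computable_open : ComputableSeq (openRep δ) U
  computable_compact : ComputableSeq (compactRep δ) B
  ce : REPred (fun z : ℕ × ℕ => R z.1 z.2)
  subset : ∀ m n, R m n → (U m).toSet ⊆ (B n).toSet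
  main : ∀ V : OpenSet δ,
    V.toSet = ⋃ n ∈ {n | (B n).toSet ⊆ V.toSet}, ⋃ m ∈ {m | R m n}, (U m).toSet

end TTE

namespace TTE

universe u v

/-! Realizers, unlike the multivalued maps they realize, are single-valued and continuous on names.
Let `x i` be the point named by the dense sequence. The pairs `(i, k)` with `x i ∈ U k` can be
enumerated. For the `j`-th pair, `CompactBase` at `(x i, U k)` gives `x i ∈ V j ⊆ K j ⊆ U k`, and
the basis map gives `n` with `x i ∈ U n ⊆ V j`. Put `B j = K j` and let `R` relate just this `n` to
`j`. To cover `y ∈ W`, pick `k` with `y ∈ U k ⊆ W` and run the same computation on a name of `y`.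
Its result `n`, with `y ∈ U n`, depends on a finite prefix of that name (`Evaluates.continuous`). By
density some `p i` shares a long enough prefix, so the pair `(i, k)` is enumerated and yields the
same `n`; hence `y ∈ U n ⊆ K j ⊆ U k ⊆ W`. -/

/-- The interleaving of two points of Baire space. -/
def interleave (p q : ℕ → ℕ) (n : ℕ) : ℕ := if n % 2 = 0 then p (n / 2) else q (n / 2)

theorem interleave_even (p q : ℕ → ℕ) : (fun n => interleave p q (2 * n)) = p := by
  funext n
  have h1 : (2 * n) % 2 = 0 := by omega
  have h2 : (2 * n) / 2 = n := by omega
  rw [interleave, if_pos h1, h2]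

theorem interleave_odd (p q : ℕ → ℕ) : (fun n => interleave p q (2 * n + 1)) = q := by
  funext n
  have h1 : ¬ (2 * n + 1) % 2 = 0 := by omega
  have h2 : (2 * n + 1) / 2 = n := by omega
  rw [interleave, if_neg h1, h2]

theorem names_interleave {X : Type u} {Y : Type v} {δ : Representation X} {ε : Representation Y}
    {p q : ℕ → ℕ} {x : X} {y : Y} (hp : δ.Names p x) (hq : ε.Names q y) :
    (prodRep δ ε).Names (interleave p q) (x, y) := by
  refine ⟨?_, ?_⟩
  · rw [interleave_even]; exact hp
  · rw [interleave_odd]; exact hq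

theorem computable_interleave {ι : Type*} [Primcodable ι] {P Q : ι → ℕ → ℕ}
    (hP : Computable₂ P) (hQ : Computable₂ Q) :
    Computable₂ fun i n => interleave (P i) (Q i) n := by
  have half : Computable fun z : ι × ℕ => z.2 / 2 :=
    (Primrec.nat_div.comp Primrec.snd (Primrec.const 2)).to_comp
  have par : Computable fun z : ι × ℕ => decide (z.2 % 2 = 0) :=
    (PrimrecPred.decide (Primrec.eq.comp (Primrec.nat_mod.comp Primrec.snd (Primrec.const 2))
      (Primrec.const 0))).to_comp
  refine (Computable.cond par (hP.comp Computable.fst half)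
    (hQ.comp Computable.fst half)).of_eq fun z => ?_
  simp [interleave, Bool.cond_decide]

theorem initSeg_succ (p : ℕ → ℕ) (n : ℕ) : initSeg p (n + 1) = initSeg p n ++ [p n] := by
  simp [initSeg, List.range_succ]

theorem initSeg_congr {p q : ℕ → ℕ} {n : ℕ} (h : ∀ i < n, p i = q i) :
    initSeg p n = initSeg q n :=
  List.map_congr_left fun i hi => h i (List.mem_range.1 hi)

theorem computable_initSeg {ι : Type*} [Primcodable ι] {P : ι → ℕ → ℕ} (hP : Computable₂ P) :
    Computable₂ fun i n => initSeg (P i) n := by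
  have step : Computable₂ fun (z : ι × ℕ) (y : ℕ × List ℕ) => y.2 ++ [P z.1 y.1] :=
    Computable.list_append.comp (Computable.snd.comp Computable.snd)
      (Computable.list_cons.comp
        (hP.comp (Computable.fst.comp Computable.fst) (Computable.fst.comp Computable.snd))
        (Computable.const []))
  refine (Computable.nat_rec Computable.snd (Computable.const []) step).of_eq fun z => ?_
  obtain ⟨i, n⟩ := z
  induction n with
  | zero => rfl
  | succ n ih => simp only [initSeg_succ] at ih ⊢; rw [← ih]

/-- A uniformly computable family of realizers, evaluated at a uniformly computable family of
points, has uniformly computable values. -/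
theorem Evaluates.computable {ι : Type*} [Primcodable ι] {a : ι → List ℕ → ℕ → Option ℕ}
    {P Q : ι → ℕ → ℕ} (ha : Computable fun z : ι × List ℕ × ℕ => a z.1 z.2.1 z.2.2)
    (hP : Computable₂ P) (h : ∀ i, Evaluates (a i) (P i) (Q i)) : Computable₂ Q := by
  have hf : Computable₂ fun (z : ι × ℕ) (n : ℕ) => a z.1 (initSeg (P z.1) n) z.2 :=
    ha.comp (Computable.pair (Computable.fst.comp Computable.fst)
      (Computable.pair
        ((computable_initSeg hP).comp (Computable.fst.comp Computable.fst) Computable.snd)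
        (Computable.snd.comp Computable.fst)))
  refine (Partrec.rfindOpt hf).of_eq_tot fun z => ?_
  obtain ⟨i, k⟩ := z
  obtain ⟨n, h1, h2⟩ := h i k
  refine Part.mem_bind (a := n) (Nat.mem_rfind.2 ⟨?_, fun {m} hm => ?_⟩) ?_
  · simp [h1]
  · simp [h2 m hm]
  · simp [h1]

theorem computable_decodeFun {ι : Type*} [Primcodable ι] {P : ι → ℕ → ℕ} (hP : Computable₂ P) :
    Computable fun z : ι × List ℕ × ℕ => decodeFun (P z.1) z.2.1 z.2.2 := by
  have hc : Computable fun z : ι × List ℕ × ℕ => P z.1 (Encodable.encode z.2) :=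
    hP.comp Computable.fst (Computable.encode.comp Computable.snd)
  refine (Computable.nat_casesOn hc (Computable.const none)
    (Computable.option_some.comp Computable.snd).to₂).of_eq fun z => ?_
  simp only [decodeFun]
  cases P z.1 (Encodable.encode z.2) <;> rfl

/-- Finitely many output symbols depend on finitely many input symbols only. -/
theorem Evaluates.continuous {a : List ℕ → ℕ → Option ℕ} {p q : ℕ → ℕ} (h : Evaluates a p q)
    (N : ℕ) : ∃ M, ∀ p' q', Evaluates a p' q' → (∀ i < M, p' i = p i) → ∀ k < N, q' k = q k := by
  choose n hn hn' using h
  -- `n k` is the prefix length at which output `k` is decided; inputs agreeing up to the largest of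
  -- these answer at the same stage.
  refine ⟨(Finset.range N).sup n, fun p' q' h' hp k hk => ?_⟩
  have hle : n k ≤ (Finset.range N).sup n := Finset.le_sup (Finset.mem_range.2 hk)
  have agree : ∀ m ≤ n k, initSeg p' m = initSeg p m := fun m hm =>
    initSeg_congr fun i hi => hp i (by omega)
  obtain ⟨m, h1, h2⟩ := h' k
  rcases lt_trichotomy m (n k) with hlt | heq | hgt
  · rw [agree m hlt.le, hn' k m hlt] at h1
    cases h1
  · rw [agree m heq.le, heq, hn k] at h1
    exact (Option.some.inj h1).symm
  · have h3 := h2 (n k) hgt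
    rw [agree _ le_rfl, hn k] at h3
    cases h3

theorem interleave_congr {p q p' q' : ℕ → ℕ} {N : ℕ} (hp : ∀ i < N, p' i = p i)
    (hq : ∀ i < N, q' i = q i) : ∀ i < N, interleave p' q' i = interleave p q i := by
  intro i hi
  have : i / 2 < N := by omega
  simp only [interleave, hp _ this, hq _ this]

/-- The whole space as an open set. -/
def OpenSet.univ {X : Type u} (δ : Representation X) : OpenSet δ :=
  -- The code `2` decodes to `some 1`: the realizer answers `1` at once, without reading input.
  ⟨fun _ => True, fun _ => 2, fun _ _ _ =>
    ⟨fun _ => 1, fun _ => ⟨0, rfl, fun _ hm => absurd hm (Nat.not_lt_zero _)⟩,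
      iff_of_true trivial ⟨0, one_ne_zero⟩⟩⟩

/-- The sequences sharing a given finite prefix form an open set of the product topology. -/
theorem exists_agree_of_mem_closure_range {p : ℕ → ℕ → ℕ} {s : ℕ → ℕ}
    (hs : s ∈ closure (Set.range p)) (M : ℕ) : ∃ i, ∀ k < M, p i k = s k := by
  have hopen : IsOpen (⋂ k ∈ Finset.range M, {t : ℕ → ℕ | t k = s k}) :=
    isOpen_biInter_finset fun k _ => (isOpen_discrete ({s k} : Set ℕ)).preimage
      (continuous_apply (A := fun _ : ℕ => ℕ) k)
  obtain ⟨_, ht, i, rfl⟩ := mem_closure_iff.1 hs _ hopen (by simp)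
  exact ⟨i, fun k hk => by simpa using Set.mem_iInter₂.1 ht k (Finset.mem_range.2 hk)⟩

/-- A nonempty computably enumerable set is the range of a computable sequence. -/
theorem exists_computable_enumeration {ι : Type*} [Denumerable ι] {r : ι → ℕ → ℕ}
    (hr : Computable₂ r) {S : ι → Prop} (hS : ∀ z, S z ↔ ∃ l, r z l ≠ 0) (z₀ : ι) (hz₀ : S z₀) :
    ∃ e : ℕ → ι, Computable e ∧ (∀ j, S (e j)) ∧ ∀ z, S z → ∃ j, e j = z := by
  have tcomp : Computable (Denumerable.ofNat (ι × ℕ)) := (Primrec.ofNat _).to_comp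
  have hdec : Computable fun w : ι × ℕ => decide (r w.1 w.2 = 0) :=
    (PrimrecPred.decide (Primrec.eq.comp Primrec.id (Primrec.const 0))).to_comp.comp hr
  -- A pair `(z, l)` contributes `z` if `l` witnesses membership, and the default `z₀` otherwise.
  have hsel : Computable fun w : ι × ℕ => bif decide (r w.1 w.2 = 0) then z₀ else w.1 :=
    Computable.cond hdec (Computable.const z₀) Computable.fst
  refine ⟨_, hsel.comp tcomp, fun j => ?_, fun z hz => ?_⟩
  · generalize Denumerable.ofNat (ι × ℕ) j = w
    by_cases h : r w.1 w.2 = 0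
    · simpa [h] using hz₀
    · simpa [h] using (hS w.1).2 ⟨_, h⟩
  · obtain ⟨l, hl⟩ := (hS z).1 hz
    exact ⟨Encodable.encode (z, l), by simp [Denumerable.ofNat_encode, hl]⟩

end TTE

open TTE in
theorem proposition8 {X : Type*} (δ : TTE.Representation X)
    (U : ℕ → TTE.OpenSet δ) (hU : TTE.IsEffectiveCountableBasis δ U)
    (δ' : TTE.Representation X) (hδ' : TTE.Equivalent δ δ')
    (p : ℕ → ℕ → ℕ) (hp : Computable₂ p) (hpdom : ∀ n, p n ∈ δ'.dom)
    (hpdense : δ'.dom ⊆ closure (Set.range p))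
    (hcb : TTE.EffectivelyLocallyCompact δ) :
    ∃ (B : ℕ → TTE.CompactSet δ) (R : ℕ → ℕ → Prop), TTE.IsErcs δ U B R := by
  obtain ⟨-, t, ht, htr⟩ := hδ'
  obtain ⟨c, hc, hcr⟩ := hcb
  obtain ⟨⟨u, hu, hun⟩, b, hb, hbr⟩ := hU
  choose x hx using hpdom
  have hd : ∀ i, ∃ d, Evaluates t (p i) d ∧ δ.Names d (x i) := fun i => by
    obtain ⟨d, y, h1, h2, rfl⟩ := htr (p i) (x i) (hx i) trivial
    exact ⟨d, h1, h2⟩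
  choose d hdt hdn using hd
  have dcomp : Computable₂ d := Evaluates.computable (a := fun _ => t)
    (ht.comp (Computable.fst.comp Computable.snd) (Computable.snd.comp Computable.snd)) hp hdt
  have hr : ∀ z : ℕ × ℕ, ∃ r, Evaluates (decodeFun (u z.2)) (d z.1) r ∧
      (x z.1 ∈ (U z.2).toSet ↔ ∃ l, r l ≠ 0) := fun z => hun z.2 _ _ (hdn z.1)
  choose r hre hrn using hr
  have ucomp : Computable₂ fun (z : ℕ × ℕ) l => u z.2 l :=
    hu.comp (Computable.snd.comp Computable.fst) Computable.snd
  have dcomp' : Computable₂ fun (z : ℕ × ℕ) l => d z.1 l :=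
    dcomp.comp (Computable.fst.comp Computable.fst) Computable.snd
  have rcomp : Computable₂ r := Evaluates.computable (a := fun z => decodeFun (u z.2))
    (computable_decodeFun ucomp) dcomp' hre
  -- a computable enumeration of the pairs `(i, k)` with `x i ∈ U k`
  obtain ⟨e, ecomp, emem, esurj⟩ : ∃ e : ℕ → ℕ × ℕ, Computable e ∧
      (∀ j, x (e j).1 ∈ (U (e j).2).toSet) ∧
      ∀ z : ℕ × ℕ, x z.1 ∈ (U z.2).toSet → ∃ j, e j = z := by
    -- The enumeration needs one valid pair to start from: some basic open set contains `x 0`.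
    obtain ⟨w, hw⟩ := (openRep δ).surjective (OpenSet.univ δ)
    obtain ⟨-, k₀, -, -, hk₀, -⟩ := hbr _ (x 0, OpenSet.univ δ)
      (names_interleave (hdn 0) hw) trivial
    exact exists_computable_enumeration (S := fun z => x z.1 ∈ (U z.2).toSet) rcomp hrn (0, k₀) hk₀
  have hq : ∀ j, ∃ (q : ℕ → ℕ) (V : OpenSet δ) (K : CompactSet δ),
      Evaluates c (interleave (d (e j).1) (u (e j).2)) q ∧
      (openRep δ).Names (fun n => q (2 * n)) V ∧ (compactRep δ).Names (fun n => q (2 * n + 1)) K ∧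
      x (e j).1 ∈ V.toSet ∧ V.toSet ⊆ K.toSet ∧ K.toSet ⊆ (U (e j).2).toSet := fun j => by
    obtain ⟨q, ⟨V, K⟩, h1, ⟨h2, h3⟩, h4, h5, h6⟩ := hcr _ (x (e j).1, U (e j).2)
      (names_interleave (hdn _) (hun _)) (emem j)
    exact ⟨q, V, K, h1, h2, h3, h4, h5, h6⟩
  choose q V K hqe hqV hqK hxV hVK hKU using hq
  have decomp : Computable₂ fun j k => d (e j).1 k :=
    dcomp.comp (Computable.fst.comp (ecomp.comp Computable.fst)) Computable.snd
  have uecomp : Computable₂ fun j k => u (e j).2 k :=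
    hu.comp (Computable.snd.comp (ecomp.comp Computable.fst)) Computable.snd
  have qcomp : Computable₂ q := Evaluates.computable (a := fun _ => c)
    (hc.comp (Computable.fst.comp Computable.snd) (Computable.snd.comp Computable.snd))
    (computable_interleave decomp uecomp) hqe
  have dbl : Computable fun z : ℕ × ℕ => 2 * z.2 :=
    (Primrec.nat_mul.comp (Primrec.const 2) Primrec.snd).to_comp
  have hn : ∀ j, ∃ n, Evaluates b (interleave (d (e j).1) fun l => q j (2 * l)) n ∧
      x (e j).1 ∈ (U (n 0)).toSet ∧ (U (n 0)).toSet ⊆ (V j).toSet := fun j => by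
    obtain ⟨n, _, h1, rfl, h2, h3⟩ := hbr _ (x (e j).1, V j)
      (names_interleave (hdn _) (hqV j)) (hxV j)
    exact ⟨n, h1, h2, h3⟩
  choose n hne hxn hnV using hn
  have evencomp : Computable₂ fun j l => q j (2 * l) := qcomp.comp Computable.fst dbl
  have ncomp : Computable₂ n := Evaluates.computable (a := fun _ => b)
    (hb.comp (Computable.fst.comp Computable.snd) (Computable.snd.comp Computable.snd))
    (computable_interleave decomp evencomp) hne
  -- A name of a natural number carries it at position `0`. This `R` is even decidable.
  refine ⟨K, fun m j => m = n j 0, ⟨u, hu, hun⟩,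
    ⟨fun j k => q j (2 * k + 1), qcomp.comp Computable.fst (Computable.succ.comp dbl), hqK⟩,
    ?_, fun m j h => h ▸ (hnV j).trans (hVK j), fun W => Set.Subset.antisymm ?_ ?_⟩
  · have h0 : Computable fun z : ℕ × ℕ => decide (z.1 = n z.2 0) :=
      (PrimrecPred.decide Primrec.eq).to_comp.comp (Computable.pair Computable.fst
        (ncomp.comp Computable.snd (Computable.const 0)))
    exact (ComputablePred.computable_iff.2 ⟨_, h0, by simp⟩).to_re
  · intro y hy
    obtain ⟨s, hs⟩ := δ'.surjective y
    obtain ⟨sd, y', hsd, hsdn, rfl⟩ := htr s y hs trivial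
    obtain ⟨w, hw⟩ := (openRep δ).surjective W
    -- Replacing `W` by `U k` makes the fixed name `u k` available, so that only the name of the
    -- point varies below.
    obtain ⟨-, k, -, -, hyk, hkW⟩ := hbr _ (y, W) (names_interleave hsdn hw) hy
    obtain ⟨sr, hsr, hsrn⟩ := hun k sd y hsdn
    obtain ⟨l, hl⟩ := hsrn.1 hyk
    obtain ⟨sq, ⟨V', K'⟩, hsq, ⟨hV', -⟩, hyV', -, -⟩ := hcr _ (y, U k)
      (names_interleave hsdn (hun k)) hyk
    obtain ⟨sn, _, hsn, rfl, hyn, -⟩ := hbr _ (y, V') (names_interleave hsdn hV') hyV'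
    -- Moduli are chosen backwards from the single symbol `sn 0`. The name of `V'` sits at the even
    -- positions of `sq`, hence `2 * M₁`; `l + 1` symbols of `sr` include the witness of `y ∈ U k`.
    obtain ⟨M₁, hM₁⟩ := hsn.continuous 1
    obtain ⟨M₂, hM₂⟩ := hsq.continuous (2 * M₁)
    obtain ⟨M₃, hM₃⟩ := hsr.continuous (l + 1)
    obtain ⟨M₄, hM₄⟩ := hsd.continuous (max M₁ (max M₂ M₃))
    obtain ⟨i, hi⟩ := exists_agree_of_mem_closure_range (hpdense ⟨y, hs⟩) M₄
    have hdi := hM₄ _ _ (hdt i) hi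
    have hxi : x i ∈ (U k).toSet := (hrn (i, k)).2 ⟨l, by
      rw [hM₃ _ _ (hre (i, k)) (fun a ha => hdi a (by simp [ha])) l l.lt_succ_self]
      exact hl⟩
    obtain ⟨j, hj⟩ := esurj (i, k) hxi
    have hqj := hqe j
    have hnj := hne j
    have hKj := hKU j
    rw [hj] at hqj hnj hKj
    have hqa := hM₂ _ _ hqj (interleave_congr (fun a ha => hdi a (by simp [ha])) fun _ _ => rfl)
    -- `V j` and `V'` may differ; it suffices that their names agree below `M₁`.
    have hna : n j 0 = sn 0 := hM₁ _ _ hnj (interleave_congr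
      (fun a ha => hdi a (by simp [ha])) fun a ha => hqa _ (by omega)) 0 one_pos
    refine Set.mem_iUnion₂.2 ⟨j, hKj.trans hkW, Set.mem_iUnion₂.2 ⟨n j 0, rfl, ?_⟩⟩
    rw [hna]
    exact hyn
  · refine Set.iUnion₂_subset fun j hj => Set.iUnion₂_subset fun m hm => ?_
    rw [show m = n j 0 from hm]
    exact ((hnV j).trans (hVK j)).trans hj
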